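/- A Garsia number is a positive real algebraic integer whose norm is $\pm 2$ and whose conjugates (including the number itself) all have modulus strictly greater than $1$. Let $\lambda\in(1/2,1)$ be the reciprocal of a Garsia number, and consider the maps $S_1,S_2:[0,1]^2\to[0,1]^2$ given by $S_1(x)=\lambda x$ and $S_2(x)=\lambda x+(1-\lambda,0)$, together with the condensation set $C=\{0\}\times[0,1]$. Let $F_C^\lambda$ be the associated inhomogeneous attractor, that is, the unique non-empty compact set $F\subseteq[0,1]^2$ satisfying $F=S_1(F)\cup S_2(F)\cup C$ (such a set exists and is unique). Then the box dimension of $F_C^\lambda$ exists and $$\dim_{\mathrm B}F_C^\lambda=\frac{\log(4\lambda)}{\log 2}>1.$$ Here, writing $N_\delta(E)$ for the smallest number of sets of diameter at most $\delta$ needed to cover a non-empty bounded set $E\subseteq\mathbb R^2$, the box dimension of $E$ is the common value of $\liminf_{\delta\to0^+}\frac{\log N_\delta(E)}{-\log\delta}$ and $\limsup_{\delta\to0^+}\frac{\log N_\delta(E)}{-\log\delta}$, when these agree. -/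

import Mathlib

/-- A Garsia number: a positive real algebraic integer of norm `2` or `-2`, all of whose
(complex) conjugates, including the number itself, have modulus strictly greater than `1`. -/
def IsGarsiaNumber (β : ℝ) : Prop :=
  0 < β ∧ IsIntegral ℤ β ∧
    (Algebra.norm ℚ (IntermediateField.AdjoinSimple.gen ℚ β) = 2 ∨
      Algebra.norm ℚ (IntermediateField.AdjoinSimple.gen ℚ β) = -2) ∧
    ∀ z : ℂ, IsConjRoot ℚ (β : ℂ) z → 1 < ‖z‖

/-- `boxCount δ E` is the smallest number of sets of diameter at most `δ` that are needed to
cover the bounded set `E`. (In a Euclidean space of positive dimension, a set of diameter at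
most `δ` can be enlarged to a set of diameter exactly `δ`, so both readings agree. The diameter
is the extended one, so that unbounded sets have infinite diameter.) -/
noncomputable def boxCount {X : Type*} [PseudoMetricSpace X] (δ : ℝ) (E : Set X) : ℕ :=
  sInf {n : ℕ | ∃ U : Fin n → Set X,
    (∀ i, Metric.ediam (U i) ≤ ENNReal.ofReal δ) ∧ E ⊆ ⋃ i, U i}

/-- Upper box dimension of a nonempty bounded set; the `limsup` is taken in the extended reals,
where it always exists. -/
noncomputable def upperBoxDim {X : Type*} [PseudoMetricSpace X] (E : Set X) : EReal :=
  Filter.limsup (fun δ : ℝ => ((Real.log (boxCount δ E) / (-Real.log δ) : ℝ) : EReal))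
    (nhdsWithin 0 (Set.Ioi 0))

/-- Lower box dimension of a nonempty bounded set. -/
noncomputable def lowerBoxDim {X : Type*} [PseudoMetricSpace X] (E : Set X) : EReal :=
  Filter.liminf (fun δ : ℝ => ((Real.log (boxCount δ E) / (-Real.log δ) : ℝ) : EReal))
    (nhdsWithin 0 (Set.Ioi 0))

/-- The box dimension of `E` exists (upper and lower box dimensions agree) and equals `d`. -/
def HasBoxDim {X : Type*} [PseudoMetricSpace X] (E : Set X) (d : ℝ) : Prop :=
  lowerBoxDim E = (d : EReal) ∧ upperBoxDim E = (d : EReal)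

/-- `F` is an inhomogeneous attractor in `X` of the iterated function system `S` with
condensation set `C`: a nonempty compact subset of `X` with `F = ⋃ i, S i (F) ∪ C`. -/
def IsInhomogeneousAttractor {E ι : Type*} [TopologicalSpace E] (X : Set E) (S : ι → E → E)
    (C : Set E) (F : Set E) : Prop :=
  F ⊆ X ∧ F.Nonempty ∧ IsCompact F ∧ F = (⋃ i, S i '' F) ∪ C

/-- The unit square `[0,1]²` in the Euclidean plane. -/
def unitSquare : Set (EuclideanSpace ℝ (Fin 2)) :=
  {p | p 0 ∈ Set.Icc (0 : ℝ) 1 ∧ p 1 ∈ Set.Icc (0 : ℝ) 1}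

/-- The two maps `x ↦ l x` and `x ↦ l x + (1 - l, 0)`. -/
noncomputable def bernoulliIFS (l : ℝ) :
    Fin 2 → EuclideanSpace ℝ (Fin 2) → EuclideanSpace ℝ (Fin 2) :=
  ![fun x => l • x, fun x => l • x + !₂[1 - l, 0]]

/-- The condensation set `{0} × [0,1]`. -/
def leftEdge : Set (EuclideanSpace ℝ (Fin 2)) :=
  {p | p 0 = 0 ∧ p 1 ∈ Set.Icc (0 : ℝ) 1}

/-! Iterating the equation for `F`, every word of length k gives a vertical segment of height λ^k
standing at the corresponding `wordPoint`. At scale 2^(-m) the 2^m segments of level m already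
account for the dimension: each holds about (2λ)^m points spaced 2^(-m), hence about (4λ)^m points
in all, and (4λ)^m = (2^m)^s for s = log(4λ)/log 2.

The lower bound needs these segments to be about 2^(-m) apart, which is Garsia's lemma
(`IsGarsiaNumber.exists_le_abs_sum`): a nonzero polynomial with coefficients in {-1, 0, 1} does not
vanish at β because the norm of β is even; its value there has norm at least 1, and the other
conjugates are bounded by geometric series.

The upper bound (`boxCount_attractor_le`) does not use the Garsia property. Segments of levels below
m meet O(∑ 2^k 2^m λ^k) grid cells, a sum dominated by its last terms because 2λ > 1, and the rest
of `F` lies in a strip of height λ^m. -/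

/-! ### Garsia's separation lemma -/

/-- The norm of an algebraic integer of a number field is an integer. -/
theorem exists_int_norm_eq {K : Type*} [Field K] [Algebra ℚ K] [FiniteDimensional ℚ K]
    {x : K} (hx : IsIntegral ℤ x) : ∃ z : ℤ, Algebra.norm ℚ x = z := by
  have h := Algebra.isIntegral_norm ℚ hx
  obtain ⟨z, hz⟩ := IsIntegrallyClosed.isIntegral_iff.1 h
  exact ⟨z, by simpa using hz.symm⟩

theorem isIntegral_sum_int_mul_pow {K : Type*} [Field K] {g : K} (hg : IsIntegral ℤ g)
    {n : ℕ} (e : Fin n → ℤ) : IsIntegral ℤ (∑ i, (e i : K) * g ^ (i : ℕ)) :=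
  IsIntegral.sum _ fun i _ => (isIntegral_algebraMap (R := ℤ) (x := e i)).mul (hg.pow _)

/-- An algebraic integer of norm `±2` is not a root of a nonzero polynomial with coefficients
in `{-1, 0, 1}`. -/
theorem sum_int_mul_pow_ne_zero {K : Type*} [Field K] [Algebra ℚ K] [FiniteDimensional ℚ K]
    {g : K} (hg : IsIntegral ℤ g)
    (hn : Algebra.norm ℚ g = 2 ∨ Algebra.norm ℚ g = -2) :
    ∀ {n : ℕ} (e : Fin n → ℤ), (∀ i, |e i| ≤ 1) → e ≠ 0 →
      ∑ i, (e i : K) * g ^ (i : ℕ) ≠ 0 := by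
  have hg0 : g ≠ 0 := by
    rintro rfl
    rw [Algebra.norm_zero] at hn
    norm_num at hn
  intro n
  induction n with
  | zero => intro e _ h; exact absurd (Subsingleton.elim _ _) h
  | succ n ih =>
    intro e he h0 hs
    have hsum : ∑ i, (e i : K) * g ^ (i : ℕ) =
        (e 0 : K) + g * ∑ i : Fin n, (e i.succ : K) * g ^ (i : ℕ) := by
      rw [Fin.sum_univ_succ, Finset.mul_sum]
      simp only [Fin.val_zero, pow_zero, mul_one, Fin.val_succ]
      congr 1
      exact Finset.sum_congr rfl fun i _ => by ring
    rw [hsum] at hs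
    by_cases h : e 0 = 0
    · have ht : (fun i : Fin n => e i.succ) ≠ 0 := by
        intro ht
        apply h0
        funext i
        refine Fin.cases h (fun j => congrFun ht j) i
      have := ih _ (fun i => he i.succ) ht
      simp [h, hg0, this] at hs
    · have h1 : e 0 = 1 ∨ e 0 = -1 := by
        have := abs_le.1 (he 0)
        omega
      set y := ∑ i : Fin n, (e i.succ : K) * g ^ (i : ℕ) with hy
      obtain ⟨z, hz⟩ := exists_int_norm_eq (isIntegral_sum_int_mul_pow hg fun i : Fin n => e i.succ)
      rw [← hy] at hz
      obtain ⟨a, ha⟩ : ∃ a : ℤ, Algebra.norm ℚ g = 2 * a := by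
        rcases hn with h | h
        · exact ⟨1, by simp [h]⟩
        · exact ⟨-1, by simp [h]⟩
      have hm : Algebra.norm ℚ (g * y) = ((2 * a * z : ℤ) : ℚ) := by
        rw [map_mul, ha, hz]; push_cast; ring
      -- The constant term is ±1, so `g * y` is ±1, although its norm is even.
      have hsq : (g * y) ^ 2 = 1 := by
        have : g * y = -(e 0 : K) := by linear_combination hs
        rw [this]
        rcases h1 with h | h <;> simp [h]
      have h2 : ((2 * a * z) ^ 2 : ℤ) = 1 := by
        have := congrArg (Algebra.norm ℚ) hsq
        rw [map_pow, hm, map_one] at this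
        exact_mod_cast this
      have h4 : (4 : ℤ) ∣ 1 := ⟨(a * z) ^ 2, by rw [← h2]; ring⟩
      norm_num at h4

theorem norm_sum_int_mul_pow_le {n : ℕ} (e : Fin n → ℤ) (he : ∀ i, |e i| ≤ 1) {z : ℂ}
    (hz : 1 < ‖z‖) : ‖∑ i, (e i : ℂ) * z ^ (i : ℕ)‖ ≤ ‖z‖ ^ n / (‖z‖ - 1) := by
  calc ‖∑ i, (e i : ℂ) * z ^ (i : ℕ)‖ ≤ ∑ i : Fin n, ‖z‖ ^ (i : ℕ) := by
        refine norm_sum_le_of_le _ fun i _ => ?_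
        rw [norm_mul, norm_pow]
        refine mul_le_of_le_one_left (by positivity) ?_
        rw [Complex.norm_intCast]
        exact_mod_cast he i
    _ = ∑ i ∈ Finset.range n, ‖z‖ ^ i := Fin.sum_univ_eq_sum_range (fun i => ‖z‖ ^ i) n
    _ = (‖z‖ ^ n - 1) / (‖z‖ - 1) := geom_sum_eq hz.ne' n
    _ ≤ _ := by
        have : 0 < ‖z‖ - 1 := by linarith
        gcongr
        linarith

open IntermediateField in
/-- Garsia's lemma. -/
theorem IsGarsiaNumber.exists_le_abs_sum {β : ℝ} (h : IsGarsiaNumber β) :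
    ∃ c : ℝ, 0 < c ∧ ∀ (n : ℕ) (e : Fin n → ℤ), (∀ i, |e i| ≤ 1) → e ≠ 0 →
      c * (β / 2) ^ n ≤ |∑ i, (e i : ℝ) * β ^ (i : ℕ)| := by
  classical
  obtain ⟨hpos, hint, hnorm, hconj⟩ := h
  have : FiniteDimensional ℚ ℚ⟮β⟯ := adjoin.finiteDimensional hint.tower_top
  set g := AdjoinSimple.gen ℚ β with hgdef
  have hgβ : algebraMap ℚ⟮β⟯ ℝ g = β := AdjoinSimple.algebraMap_gen ℚ β
  have hg : IsIntegral ℤ g := by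
    rw [← isIntegral_algebraMap_iff (algebraMap ℚ⟮β⟯ ℝ).injective, hgβ]
    exact hint
  let σ₀ : ℚ⟮β⟯ →ₐ[ℚ] ℂ := (Complex.ofRealAm.restrictScalars ℚ).comp ℚ⟮β⟯.val
  have hσ₀ : ∀ x, σ₀ x = ((algebraMap ℚ⟮β⟯ ℝ x : ℝ) : ℂ) := fun x => rfl
  have hσ : ∀ σ : ℚ⟮β⟯ →ₐ[ℚ] ℂ, 1 < ‖σ g‖ := by
    intro σ
    apply hconj
    rw [IsConjRoot, minpoly.algHom_eq σ σ.toRingHom.injective,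
      ← minpoly.algHom_eq σ₀ σ₀.toRingHom.injective, hσ₀, hgβ]
  have hprod : ∀ x : ℚ⟮β⟯, |((Algebra.norm ℚ x : ℚ) : ℝ)| =
      |algebraMap ℚ⟮β⟯ ℝ x| * ∏ σ ∈ Finset.univ.erase σ₀, ‖σ x‖ := by
    intro x
    have h1 := congrArg norm (Algebra.norm_eq_prod_embeddings ℚ ℂ x)
    rw [norm_prod, ← Finset.mul_prod_erase _ _ (Finset.mem_univ σ₀), hσ₀, Complex.norm_real,
      Real.norm_eq_abs] at h1
    rw [← h1, eq_ratCast, Complex.norm_ratCast]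
  set P := ∏ σ ∈ Finset.univ.erase σ₀, ‖σ g‖ with hP
  -- The other conjugates have product of moduli 2/β; this is what turns `P ^ n` into the rate
  -- (β/2)^n.
  have hβP : β * P = 2 := by
    have := hprod g
    rw [hgβ, abs_of_pos hpos] at this
    rw [← this]
    rcases hnorm with h | h <;> rw [h] <;> norm_num
  -- This collects the denominators of the geometric-series bounds, which do not depend on n.
  refine ⟨∏ σ ∈ Finset.univ.erase σ₀, (‖σ g‖ - 1),
    Finset.prod_pos fun σ _ => by linarith [hσ σ], ?_⟩
  intro n e he h0
  set c := ∏ σ ∈ Finset.univ.erase σ₀, (‖σ g‖ - 1) with hc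
  have hcpos : 0 < c := Finset.prod_pos fun σ _ => by linarith [hσ σ]
  set y := ∑ i, (e i : ℚ⟮β⟯) * g ^ (i : ℕ) with hy
  have hyβ : algebraMap ℚ⟮β⟯ ℝ y = ∑ i, (e i : ℝ) * β ^ (i : ℕ) := by
    rw [hy, map_sum]
    refine Finset.sum_congr rfl fun i _ => ?_
    rw [map_mul, map_pow, hgβ, map_intCast]
  have hy0 : y ≠ 0 := sum_int_mul_pow_ne_zero hg hnorm e he h0
  have hone : 1 ≤ |((Algebra.norm ℚ y : ℚ) : ℝ)| := by
    obtain ⟨z, hz⟩ := exists_int_norm_eq (isIntegral_sum_int_mul_pow hg e)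
    rw [← hy] at hz
    have hz0 : z ≠ 0 := by
      rintro rfl
      exact hy0 ((Algebra.norm_eq_zero_iff (R := ℚ)).1 (by rw [hz, Int.cast_zero]))
    rw [hz]
    exact_mod_cast Int.one_le_abs hz0
  have hle : ∏ σ ∈ Finset.univ.erase σ₀, ‖σ y‖ ≤ P ^ n / c := by
    rw [hP, hc, ← Finset.prod_pow, ← Finset.prod_div_distrib]
    refine Finset.prod_le_prod (fun _ _ => norm_nonneg _) fun σ _ => ?_
    have : σ y = ∑ i, (e i : ℂ) * (σ g) ^ (i : ℕ) := by
      rw [hy, map_sum]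
      exact Finset.sum_congr rfl fun i _ => by rw [map_mul, map_pow, map_intCast]
    rw [this]
    exact norm_sum_int_mul_pow_le e he (hσ σ)
  rw [hprod, hyβ] at hone
  have hfin := hone.trans (mul_le_mul_of_nonneg_left hle (abs_nonneg _))
  have hPβ : P ^ n * (β / 2) ^ n = 1 := by
    rw [← mul_pow, show P * (β / 2) = 1 by linarith, one_pow]
  calc c * (β / 2) ^ n = c * (β / 2) ^ n * 1 := by ring
    _ ≤ c * (β / 2) ^ n * (|∑ i, (e i : ℝ) * β ^ (i : ℕ)| * (P ^ n / c)) := by gcongr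
    _ = |∑ i, (e i : ℝ) * β ^ (i : ℕ)| * (P ^ n * (β / 2) ^ n) := by field_simp
    _ = _ := by rw [hPβ, mul_one]

/-! ### Separation of the segments -/

/-- The horizontal positions `(1 - l) ∑ wₖ lᵏ` of the pieces of the attractor. -/
noncomputable def wordPoint (l : ℝ) {n : ℕ} (w : Fin n → Fin 2) : ℝ :=
  (1 - l) * ∑ i, ((w i : ℕ) : ℝ) * l ^ (i : ℕ)

theorem wordPoint_cons (l : ℝ) {n : ℕ} (a : Fin 2) (w : Fin n → Fin 2) :
    wordPoint l (Fin.cons a w : Fin (n + 1) → Fin 2) =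
      l * wordPoint l w + ((a : ℕ) : ℝ) * (1 - l) := by
  simp only [wordPoint, Fin.sum_univ_succ, Fin.cons_zero, Fin.cons_succ, Fin.val_zero, pow_zero,
    mul_one, Fin.val_succ]
  have : ∑ i : Fin n, ((w i : ℕ) : ℝ) * l ^ ((i : ℕ) + 1) =
      l * ∑ i : Fin n, ((w i : ℕ) : ℝ) * l ^ (i : ℕ) := by
    rw [Finset.mul_sum]
    exact Finset.sum_congr rfl fun i _ => by ring
  rw [this]
  ring

/-- For the reciprocal of a Garsia number, distinct words of length `n` give points at distance
at least a constant times `2⁻ⁿ`. -/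
theorem exists_le_abs_wordPoint_sub {l β : ℝ} (hl1 : l < 1) (h : IsGarsiaNumber β)
    (hlβ : l = 1 / β) : ∃ c : ℝ, 0 < c ∧ ∀ (n : ℕ) (v w : Fin n → Fin 2), v ≠ w →
      c / 2 ^ n ≤ |wordPoint l v - wordPoint l w| := by
  obtain ⟨c, hc, H⟩ := h.exists_le_abs_sum
  have hβ : 0 < β := h.1
  refine ⟨(1 - l) * (c * β), by nlinarith [mul_pos hc hβ], fun n v w hvw => ?_⟩
  cases n with
  | zero => exact absurd (Subsingleton.elim _ _) hvw
  | succ n =>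
    -- The digits are reversed because λ^i = β^(n-i) / β^n.
    let e : Fin (n + 1) → ℤ := fun i => ((v i.rev : ℕ) : ℤ) - ((w i.rev : ℕ) : ℤ)
    have he : ∀ i, |e i| ≤ 1 := by
      intro i
      have h1 := (v i.rev).isLt
      have h2 := (w i.rev).isLt
      simp only [e, abs_le]
      omega
    have he0 : e ≠ 0 := by
      intro h0
      apply hvw
      funext i
      have := congrFun h0 i.rev
      simp only [e, Fin.rev_rev, Pi.zero_apply] at this
      exact Fin.ext (by omega)
    have hsum : wordPoint l v - wordPoint l w =
        (1 - l) * (1 / β ^ n * ∑ i, (e i : ℝ) * β ^ (i : ℕ)) := by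
      rw [wordPoint, wordPoint, ← mul_sub, ← Finset.sum_sub_distrib,
        ← Equiv.sum_comp Fin.revPerm fun i : Fin (n + 1) =>
          ((v i : ℕ) : ℝ) * l ^ (i : ℕ) - ((w i : ℕ) : ℝ) * l ^ (i : ℕ)]
      congr 1
      rw [Finset.mul_sum]
      refine Finset.sum_congr rfl fun i _ => ?_
      have hi : (i : ℕ) ≤ n := Nat.lt_succ_iff.1 i.isLt
      have hb : β ^ n = β ^ (n - (i : ℕ)) * β ^ (i : ℕ) := by rw [← pow_add, Nat.sub_add_cancel hi]
      simp only [Fin.revPerm_apply, e, Fin.val_rev, hlβ, Nat.add_sub_add_right, hb,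
        one_div_pow]
      push_cast
      field_simp
    have hl : 0 < 1 - l := by linarith
    rw [hsum, abs_mul, abs_mul, abs_of_pos hl, abs_of_pos (by positivity : 0 < 1 / β ^ n)]
    calc (1 - l) * (c * β) / 2 ^ (n + 1) = (1 - l) * (1 / β ^ n * (c * (β / 2) ^ (n + 1))) := by
          rw [div_pow]
          field_simp
          ring
      _ ≤ _ := by
          gcongr
          exact H _ e he he0

/-! ### Box counting -/

open Filter Topology in
/-- A set whose covering numbers are comparable to `δ⁻ˢ` has box dimension `s`. -/
theorem hasBoxDim_of_boxCount_bounds {X : Type*} [PseudoMetricSpace X] {E : Set X} {s A B : ℝ}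
    (hA : 0 < A) (hlow : ∀ᶠ δ in 𝓝[>] (0 : ℝ), A * δ ^ (-s) ≤ boxCount δ E)
    (hup : ∀ᶠ δ in 𝓝[>] (0 : ℝ), (boxCount δ E : ℝ) ≤ B * δ ^ (-s)) : HasBoxDim E s := by
  have hlog : Tendsto (fun δ : ℝ => -Real.log δ) (𝓝[>] 0) atTop :=
    tendsto_neg_atBot_atTop.comp Real.tendsto_log_nhdsGT_zero
  have hlim : ∀ D : ℝ, Tendsto (fun δ : ℝ => Real.log D / (-Real.log δ) + s) (𝓝[>] 0) (𝓝 s) := by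
    intro D
    simpa using (hlog.const_div_atTop (Real.log D)).add_const s
  have hlt : ∀ᶠ δ in 𝓝[>] (0 : ℝ), 0 < -Real.log δ := hlog.eventually_gt_atTop 0
  have hform : ∀ {D δ : ℝ}, 0 < D → 0 < δ → 0 < -Real.log δ →
      Real.log D / (-Real.log δ) + s = Real.log (D * δ ^ (-s)) / (-Real.log δ) := by
    intro D δ hD hδ h
    rw [Real.log_mul hD.ne' (Real.rpow_pos_of_pos hδ _).ne', Real.log_rpow hδ]
    have h' : Real.log δ ≠ 0 := (neg_pos.1 h).ne
    field_simp
    ring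
  have key : Tendsto (fun δ : ℝ => Real.log (boxCount δ E) / (-Real.log δ)) (𝓝[>] 0) (𝓝 s) := by
    refine tendsto_of_tendsto_of_tendsto_of_le_of_le' (hlim A) (hlim B) ?_ ?_
    · filter_upwards [hlow, hlt, self_mem_nhdsWithin] with δ h1 h2 h3
      have h3 : 0 < δ := h3
      have : 0 < A * δ ^ (-s) := mul_pos hA (Real.rpow_pos_of_pos h3 _)
      rw [hform hA h3 h2]
      gcongr
    · filter_upwards [hlow, hup, hlt, self_mem_nhdsWithin] with δ h0 h1 h2 h3
      have h3 : 0 < δ := h3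
      have h4 : 0 < A * δ ^ (-s) := mul_pos hA (Real.rpow_pos_of_pos h3 _)
      have hB : 0 < B := pos_of_mul_pos_left (h4.trans_le (h0.trans h1)) (Real.rpow_nonneg h3.le _)
      rw [hform hB h3 h2]
      have := h4.trans_le h0
      gcongr
  have key' := (continuous_coe_real_ereal.tendsto s).comp key
  exact ⟨key'.liminf_eq, key'.limsup_eq⟩

/-- A family of points of `E` with mutual distances larger than `δ` has at most `boxCount δ E`
members, provided that `E` has a finite cover by sets of diameter at most `δ`. -/
theorem card_le_boxCount {X ι : Type*} [PseudoMetricSpace X] [Fintype ι] {E : Set X} {δ : ℝ}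
    (hδ : 0 < δ) (hE : TotallyBounded E) (f : ι → X) (hf : ∀ i, f i ∈ E)
    (hsep : ∀ i j, i ≠ j → δ < dist (f i) (f j)) : Fintype.card ι ≤ boxCount δ E := by
  have hne : {n : ℕ | ∃ U : Fin n → Set X,
      (∀ i, Metric.ediam (U i) ≤ ENNReal.ofReal δ) ∧ E ⊆ ⋃ i, U i}.Nonempty := by
    obtain ⟨t, ht, hcov⟩ := Metric.totallyBounded_iff.1 hE (δ / 2) (by positivity)
    have := ht.fintype
    refine ⟨Fintype.card t, fun i => Metric.ball ((Fintype.equivFin t).symm i : X) (δ / 2),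
      fun i => ?_, ?_⟩
    · refine Metric.ediam_le fun x hx y hy => ?_
      rw [edist_dist]
      refine ENNReal.ofReal_le_ofReal ?_
      have := dist_triangle_right x y ((Fintype.equivFin t).symm i : X)
      linarith [Metric.mem_ball.1 hx, Metric.mem_ball.1 hy]
    · intro x hx
      obtain ⟨y, hy, hxy⟩ := Set.mem_iUnion₂.1 (hcov hx)
      exact Set.mem_iUnion.2 ⟨Fintype.equivFin t ⟨y, hy⟩, by simpa using hxy⟩
  obtain ⟨U, hU, hcov⟩ := Nat.sInf_mem hne
  choose g hg using fun i => Set.mem_iUnion.1 (hcov (hf i))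
  have hinj : Function.Injective g := by
    intro i j hij
    by_contra hne
    have h1 := (Metric.edist_le_ediam_of_mem (hg i) (hij ▸ hg j)).trans (hU (g i))
    rw [edist_dist, ENNReal.ofReal_le_ofReal_iff hδ.le] at h1
    exact absurd (hsep i j hne) (not_lt.2 h1)
  simpa [boxCount] using Fintype.card_le_of_injective g hinj

/-- If the nonempty fibres of a map on `E` have diameter at most `δ`, and the map takes its values
on `E` in a finite set `T`, then `boxCount δ E` is at most the number of elements of `T`. -/
theorem boxCount_le_card {X κ : Type*} [PseudoMetricSpace X] {E : Set X} {δ : ℝ} (T : Finset κ)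
    (q : X → κ) (hq : ∀ x ∈ E, q x ∈ T) (hδ : ∀ x y, q x = q y → dist x y ≤ δ) :
    boxCount δ E ≤ T.card := by
  refine Nat.sInf_le ⟨fun i => {x | q x = T.equivFin.symm i}, fun i => ?_, fun x hx => ?_⟩
  · refine Metric.ediam_le fun x hx y hy => ?_
    rw [edist_dist]
    exact ENNReal.ofReal_le_ofReal (hδ x y (hx.trans hy.symm))
  · exact Set.mem_iUnion.2 ⟨T.equivFin ⟨q x, hq x hx⟩, by simp⟩

/-- Two points of the plane in the same cell of the grid of mesh `1 / M` are at distance at most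
`2 / M`. -/
theorem dist_le_of_floor_eq {M : ℝ} (hM : 0 < M) {x y : EuclideanSpace ℝ (Fin 2)}
    (h0 : ⌊M * x 0⌋ = ⌊M * y 0⌋) (h1 : ⌊M * x 1⌋ = ⌊M * y 1⌋) : dist x y ≤ 2 / M := by
  have hcoord : ∀ {a b : ℝ}, ⌊M * a⌋ = ⌊M * b⌋ → (a - b) ^ 2 ≤ (1 / M) ^ 2 := by
    intro a b h
    have := Int.abs_sub_lt_one_of_floor_eq_floor h
    rw [← mul_sub, abs_mul, abs_of_pos hM] at this
    rw [sq_le_sq, abs_of_pos (by positivity : 0 < 1 / M), le_div_iff₀ hM]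
    linarith
  rw [EuclideanSpace.dist_eq, Fin.sum_univ_two, Real.dist_eq, Real.dist_eq, sq_abs, sq_abs]
  refine Real.sqrt_le_iff.2 ⟨by positivity, ?_⟩
  have e : (2 / M) ^ 2 = 4 * (1 / M) ^ 2 := by ring
  nlinarith [hcoord h0, hcoord h1, sq_nonneg (1 / M)]

theorem abs_sub_le_dist (x y : EuclideanSpace ℝ (Fin 2)) (i : Fin 2) : |x i - y i| ≤ dist x y := by
  rw [dist_eq_norm, ← Real.norm_eq_abs]
  exact PiLp.norm_apply_le (x - y) i

/-! ### The maps; existence and uniqueness of the attractor -/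

theorem bernoulliIFS_apply_zero (l : ℝ) (i : Fin 2) (p : EuclideanSpace ℝ (Fin 2)) :
    bernoulliIFS l i p 0 = l * p 0 + ((i : ℕ) : ℝ) * (1 - l) := by
  fin_cases i <;> simp [bernoulliIFS]

theorem bernoulliIFS_apply_one (l : ℝ) (i : Fin 2) (p : EuclideanSpace ℝ (Fin 2)) :
    bernoulliIFS l i p 1 = l * p 1 := by
  fin_cases i <;> simp [bernoulliIFS]

theorem dist_bernoulliIFS {l : ℝ} (hl : 0 < l) (i : Fin 2) (p q : EuclideanSpace ℝ (Fin 2)) :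
    dist (bernoulliIFS l i p) (bernoulliIFS l i q) = l * dist p q := by
  fin_cases i <;> simp [bernoulliIFS, dist_smul₀, abs_of_pos hl]

theorem continuous_bernoulliIFS (l : ℝ) (i : Fin 2) : Continuous (bernoulliIFS l i) := by
  fin_cases i <;> simp only [bernoulliIFS] <;> dsimp <;> fun_prop

theorem bernoulliIFS_injective {l : ℝ} (hl : 0 < l) (i : Fin 2) :
    Function.Injective (bernoulliIFS l i) := by
  intro p q h
  have := dist_bernoulliIFS hl i p q
  rw [h, dist_self] at this
  exact dist_eq_zero.1 (by simpa [hl.ne'] using this.symm)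

theorem isCompact_unitSquare : IsCompact unitSquare := by
  have : unitSquare = (EuclideanSpace.equiv (Fin 2) ℝ).toHomeomorph ⁻¹'
      (Set.univ.pi fun _ => Set.Icc (0 : ℝ) 1) := by
    ext p
    simp only [unitSquare, Set.mem_ofPred_eq, Set.mem_preimage, Set.mem_univ_pi, Fin.forall_fin_two]
    rfl
  rw [this, Homeomorph.isCompact_preimage]
  exact isCompact_univ_pi fun _ => isCompact_Icc

theorem leftEdge_subset_unitSquare : leftEdge ⊆ unitSquare := by
  rintro p ⟨h0, h1⟩
  exact ⟨by simp [h0], h1⟩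

theorem isClosed_leftEdge : IsClosed leftEdge := by
  have h : ∀ i : Fin 2, Continuous fun p : EuclideanSpace ℝ (Fin 2) => p i := fun i => by fun_prop
  exact (isClosed_eq (h 0) continuous_const).inter (isClosed_Icc.preimage (h 1))

theorem isCompact_leftEdge : IsCompact leftEdge :=
  isCompact_unitSquare.of_isClosed_subset isClosed_leftEdge leftEdge_subset_unitSquare

theorem bernoulliIFS_mem_unitSquare {l : ℝ} (hl : 0 < l) (hl1 : l < 1) (i : Fin 2)
    {p : EuclideanSpace ℝ (Fin 2)} (hp : p ∈ unitSquare) : bernoulliIFS l i p ∈ unitSquare := by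
  obtain ⟨⟨h1, h2⟩, h3, h4⟩ := hp
  have hi : ((i : ℕ) : ℝ) ≤ 1 := by exact_mod_cast Nat.lt_succ_iff.1 i.isLt
  have hi0 : (0 : ℝ) ≤ ((i : ℕ) : ℝ) := Nat.cast_nonneg _
  refine ⟨⟨?_, ?_⟩, ?_, ?_⟩ <;>
    simp only [bernoulliIFS_apply_zero, bernoulliIFS_apply_one] <;>
    nlinarith [mul_nonneg hl.le h1, mul_nonneg hi0 (by linarith : 0 ≤ 1 - l), mul_nonneg hl.le h3]

/-- Take a point of `F` farthest from `G`. If it is `S i q`, contraction makes its distance to `G`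
at most `l` times that of `q`, so the maximum is zero. Applied both ways, this gives uniqueness. -/
theorem IsInhomogeneousAttractor.subset_of_contracting {E ι : Type*} [PseudoMetricSpace E]
    {X C F G : Set E} {S : ι → E → E} {l : ℝ} (hl : 0 < l) (hl1 : l < 1)
    (hS : ∀ i p q, dist (S i p) (S i q) = l * dist p q)
    (hF : IsInhomogeneousAttractor X S C F) (hG : IsInhomogeneousAttractor X S C G)
    (hGc : IsClosed G) : F ⊆ G := by
  obtain ⟨-, hFne, hFc, hFe⟩ := hF
  obtain ⟨-, hGne, -, hGe⟩ := hG
  obtain ⟨p, hp, hmax⟩ := hFc.exists_isMaxOn hFne (Metric.continuous_infDist_pt G).continuousOn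
  have hle : Metric.infDist p G ≤ 0 := by
    rw [hFe] at hp
    rcases hp with hp | hp
    · obtain ⟨i, q, hq, rfl⟩ := Set.mem_iUnion.1 hp
      have h1 : Metric.infDist (S i q) G ≤ l * Metric.infDist q G := by
        rw [← div_le_iff₀' hl]
        refine (Metric.le_infDist hGne).2 fun y hy => ?_
        rw [div_le_iff₀' hl, ← hS i]
        refine Metric.infDist_le_dist_of_mem ?_
        rw [hGe]
        exact Or.inl (Set.mem_iUnion.2 ⟨i, y, hy, rfl⟩)
      have h2 : Metric.infDist q G ≤ Metric.infDist (S i q) G := hmax hq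
      nlinarith
    · have : p ∈ G := by rw [hGe]; exact Or.inr hp
      exact (Metric.infDist_zero_of_mem this).le
  intro x hx
  rw [hGc.mem_iff_infDist_zero hGne]
  exact le_antisymm ((hmax hx).trans hle) Metric.infDist_nonneg

/-- Existence of the inhomogeneous attractor of finitely many injective continuous maps of a compact
set, as the intersection of the iterates of that set. -/
theorem exists_isInhomogeneousAttractor {E ι : Type*} [TopologicalSpace E] [T2Space E] [Finite ι]
    {X C : Set E} {S : ι → E → E} (hX : IsCompact X) (hC : IsCompact C) (hCX : C ⊆ X)
    (hCne : C.Nonempty) (hS : ∀ i, Continuous (S i)) (hinj : ∀ i, Function.Injective (S i))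
    (hSX : ∀ i, Set.MapsTo (S i) X X) : ∃ F, IsInhomogeneousAttractor X S C F := by
  let Φ : Set E → Set E := fun K => (⋃ i, S i '' K) ∪ C
  have hmono : Monotone Φ := fun K L h =>
    Set.union_subset_union_left _ (Set.iUnion_mono fun i => Set.image_mono h)
  let K : ℕ → Set E := fun n => Φ^[n] X
  have hK : ∀ n, K (n + 1) = Φ (K n) := fun n => Function.iterate_succ_apply' Φ n X
  have hanti : Antitone K := by
    refine antitone_nat_of_succ_le fun n => ?_
    induction n with
    | zero =>
      rw [hK]
      exact Set.union_subset (Set.iUnion_subset fun i => (hSX i).image_subset) hCX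
    | succ n ih =>
      have := hmono ih
      rwa [← hK, ← hK] at this
  have hcomp : ∀ n, IsCompact (K n) := by
    intro n
    induction n with
    | zero => exact hX
    | succ n ih =>
      rw [hK]
      exact (isCompact_iUnion fun i => ih.image (hS i)).union hC
  have hCK : ∀ n, C ⊆ K n := by
    intro n
    cases n with
    | zero => exact hCX
    | succ n => rw [hK]; exact Set.subset_union_right
  refine ⟨⋂ n, K n, Set.iInter_subset K 0, hCne.mono (Set.subset_iInter hCK),
    hX.of_isClosed_subset (isClosed_iInter fun n => (hcomp n).isClosed) (Set.iInter_subset K 0), Set.Subset.antisymm ?_ ?_⟩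
  · intro p hp
    by_cases hpC : p ∈ C
    · exact Or.inr hpC
    left
    have h1 : ∀ n, ∃ i, p ∈ S i '' K n := by
      intro n
      have := Set.mem_iInter.1 hp (n + 1)
      rw [hK] at this
      exact Set.mem_iUnion.1 (this.resolve_right hpC)
    choose i hi using h1
    -- One map serves infinitely many n, hence all n since the iterates decrease; injectivity then
    -- makes the preimage the same point throughout.
    obtain ⟨j, hj⟩ := Finite.exists_infinite_fiber i
    have hj' : (i ⁻¹' {j}).Infinite := Set.infinite_coe_iff.1 hj
    have hall : ∀ n, p ∈ S j '' K n := by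
      intro n
      obtain ⟨m, hm, hnm⟩ := hj'.exists_gt n
      have hm : i m = j := hm
      exact Set.image_mono (hanti hnm.le) (hm ▸ hi m)
    obtain ⟨q, -, rfl⟩ := hall 0
    refine Set.mem_iUnion.2 ⟨j, q, Set.mem_iInter.2 fun n => ?_, rfl⟩
    exact ((hinj j).mem_set_image).1 (hall n)
  · refine Set.subset_iInter fun n => ?_
    have : (⋃ i, S i '' ⋂ n, K n) ∪ C ⊆ K (n + 1) := by
      rw [hK]
      exact hmono (Set.iInter_subset K n)
    exact this.trans (hanti n.le_succ)

/-! ### Covering numbers of the attractor -/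

section Attractor

variable {l : ℝ} {F : Set (EuclideanSpace ℝ (Fin 2))}

/-- These points form the image of the left edge under the composition of maps coded by `w`. -/
theorem mem_attractor_of_wordPoint (hl : 0 < l)
    (hF : IsInhomogeneousAttractor unitSquare (bernoulliIFS l) leftEdge F) :
    ∀ {n : ℕ} (w : Fin n → Fin 2) (p : EuclideanSpace ℝ (Fin 2)), p 0 = wordPoint l w →
      0 ≤ p 1 → p 1 ≤ l ^ n → p ∈ F := by
  intro n
  induction n with
  | zero =>
    intro w p h0 h1 h2
    rw [hF.2.2.2]
    exact Or.inr ⟨by simpa [wordPoint] using h0, h1, by simpa using h2⟩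
  | succ n ih =>
    intro w p h0 h1 h2
    rw [← Fin.cons_self_tail w, wordPoint_cons] at h0
    rw [hF.2.2.2]
    refine Or.inl (Set.mem_iUnion.2 ⟨w 0, !₂[wordPoint l (Fin.tail w), p 1 / l],
      ih (Fin.tail w) _ (by simp) ?_ ?_, ?_⟩)
    · simpa using div_nonneg h1 hl.le
    · simpa [div_le_iff₀ hl, ← pow_succ] using h2
    · ext i
      fin_cases i
      · simp only [Fin.zero_eta, bernoulliIFS_apply_zero, h0]
        simp
      · simp only [Fin.mk_one, bernoulliIFS_apply_one]
        simp
        field_simp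

/-- Unfold the equation m times: a point lies in an m-fold image of the unit square or on a segment
of an earlier level. -/
theorem attractor_cases (hl : 0 < l)
    (hF : IsInhomogeneousAttractor unitSquare (bernoulliIFS l) leftEdge F) (m : ℕ) :
    ∀ p ∈ F, p 1 ≤ l ^ m ∨ ∃ k < m, ∃ w : Fin k → Fin 2, p 0 = wordPoint l w ∧ p 1 ≤ l ^ k := by
  induction m with
  | zero => exact fun p hp => Or.inl (by simpa using (hF.1 hp).2.2)
  | succ m ih =>
    intro p hp
    rw [hF.2.2.2] at hp
    rcases hp with hp | hp
    · obtain ⟨i, q, hq, rfl⟩ := Set.mem_iUnion.1 hp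
      rw [bernoulliIFS_apply_zero, bernoulliIFS_apply_one]
      rcases ih q hq with h | ⟨k, hk, w, h0, h1⟩
      · left
        rw [pow_succ']
        gcongr
      · refine Or.inr ⟨k + 1, by omega, Fin.cons i w, ?_, ?_⟩
        · rw [wordPoint_cons, h0]
        · rw [pow_succ']
          gcongr
    · refine Or.inr ⟨0, by omega, Fin.elim0, ?_, ?_⟩
      · simpa [wordPoint] using hp.1
      · simpa using hp.2.2

/-- Points spaced 2^(-m) along all level-m segments are δ-separated: horizontally by `hc`,
vertically because c ≤ 1. -/
theorem le_boxCount_attractor (hl : 0 < l) {c δ : ℝ} (hc1 : c ≤ 1)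
    (hc : ∀ (n : ℕ) (v w : Fin n → Fin 2), v ≠ w →
      c / 2 ^ n ≤ |wordPoint l v - wordPoint l w|)
    (hF : IsInhomogeneousAttractor unitSquare (bernoulliIFS l) leftEdge F) {m : ℕ}
    (hδ : 0 < δ) (hδm : δ < c / 2 ^ m) : (4 * l) ^ m ≤ boxCount δ F := by
  let J := ⌊(2 * l) ^ m⌋₊ + 1
  have hcard := card_le_boxCount (ι := (Fin m → Fin 2) × Fin J) hδ hF.2.2.1.totallyBounded
    (fun i => !₂[wordPoint l i.1, ((i.2 : ℕ) : ℝ) / 2 ^ m]) ?_ ?_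
  · rw [Fintype.card_prod, Fintype.card_fun, Fintype.card_fin, Fintype.card_fin,
      Fintype.card_fin] at hcard
    calc (4 * l) ^ m = 2 ^ m * (2 * l) ^ m := by rw [← mul_pow]; ring
      _ ≤ 2 ^ m * (J : ℝ) := by
          gcongr
          simpa [J] using (Nat.lt_floor_add_one ((2 * l) ^ m)).le
      _ ≤ _ := by exact_mod_cast hcard
  · rintro ⟨w, j⟩
    refine mem_attractor_of_wordPoint hl hF w _ (by simp) ?_ ?_
    · simp; positivity
    · have h1 : ((j : ℕ) : ℝ) ≤ (2 * l) ^ m :=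
        (Nat.cast_le.2 (Nat.lt_succ_iff.1 j.isLt)).trans (Nat.floor_le (by positivity))
      simp only [Matrix.cons_val_one, Matrix.cons_val_fin_one]
      rw [div_le_iff₀ (by positivity), ← mul_pow, mul_comm l]
      exact h1
  · rintro ⟨v, i⟩ ⟨w, j⟩ hne
    refine hδm.trans_le ?_
    by_cases hvw : v = w
    · subst hvw
      have hij : i ≠ j := fun h => hne (by rw [h])
      refine le_trans ?_ (abs_sub_le_dist _ _ 1)
      simp only [Matrix.cons_val_one, Matrix.cons_val_fin_one]
      rw [← sub_div, abs_div, abs_of_pos (by positivity : (0 : ℝ) < 2 ^ m)]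
      gcongr
      refine hc1.trans ?_
      have : (1 : ℤ) ≤ |((i : ℕ) : ℤ) - ((j : ℕ) : ℤ)| :=
        Int.one_le_abs (sub_ne_zero.2 fun h => hij (Fin.ext (by exact_mod_cast h)))
      exact_mod_cast this
    · refine le_trans (hc m v w hvw) ((abs_sub_le_dist _ _ 0).trans' ?_)
      simp

theorem boxCount_attractor_le (hl : 1 / 2 < l) (hl1 : l < 1) {δ : ℝ}
    (hF : IsInhomogeneousAttractor unitSquare (bernoulliIFS l) leftEdge F) {m : ℕ}
    (hδm : 2 / 2 ^ m ≤ δ) : (boxCount δ F : ℝ) ≤ (4 + 2 / (2 * l - 1)) * (4 * l) ^ m := by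
  classical
  have hl0 : 0 < l := by linarith
  let M : ℝ := 2 ^ m
  have hM : 0 < M := by positivity
  -- Cells of mesh 2^(-m): the bottom strip of height λ^m, then one column for each shorter word.
  let T : Finset (ℤ × ℤ) := Finset.Icc 0 (2 ^ m) ×ˢ Finset.Icc 0 ⌊M * l ^ m⌋ ∪
    (Finset.range m).biUnion fun k => (Finset.univ : Finset (Fin k → Fin 2)).biUnion fun w =>
      {⌊M * wordPoint l w⌋} ×ˢ Finset.Icc 0 ⌊M * l ^ k⌋
  have hT : ∀ p ∈ F, (⌊M * p 0⌋, ⌊M * p 1⌋) ∈ T := by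
    intro p hp
    obtain ⟨⟨h1, h2⟩, h3, h4⟩ := hF.1 hp
    have hfl : ∀ {k : ℕ}, p 1 ≤ l ^ k → ⌊M * p 1⌋ ∈ Finset.Icc 0 ⌊M * l ^ k⌋ := fun h =>
      Finset.mem_Icc.2 ⟨Int.floor_nonneg.2 (by positivity), Int.floor_le_floor (by gcongr)⟩
    rcases attractor_cases hl0 hF m p hp with h | ⟨k, hk, w, h0, h⟩
    · refine Finset.mem_union_left _ (Finset.mem_product.2 ⟨?_, hfl h⟩)
      refine Finset.mem_Icc.2 ⟨Int.floor_nonneg.2 (by positivity), ?_⟩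
      have : M * p 0 ≤ ((2 ^ m : ℤ) : ℝ) := by
        push_cast
        exact mul_le_of_le_one_right hM.le h2
      exact_mod_cast (Int.floor_le _).trans this
    · refine Finset.mem_union_right _ (Finset.mem_biUnion.2 ⟨k, Finset.mem_range.2 hk,
        Finset.mem_biUnion.2 ⟨w, Finset.mem_univ _, Finset.mem_product.2 ⟨?_, hfl h⟩⟩⟩)
      simp [h0]
  have hcount := boxCount_le_card T _ hT (δ := δ) fun x y h =>
    (dist_le_of_floor_eq hM (congrArg Prod.fst h) (congrArg Prod.snd h)).trans hδm
  have hcol : ∀ k ≤ m, ((Finset.Icc 0 ⌊M * l ^ k⌋).card : ℝ) ≤ 2 * (M * l ^ k) := by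
    intro k hk
    -- Columns are at least one cell high, so the extra 1 from rounding costs only a factor 2.
    have h1 : 1 ≤ M * l ^ k := by
      calc (1 : ℝ) ≤ (2 * l) ^ m := one_le_pow₀ (by linarith)
        _ = M * l ^ m := mul_pow _ _ _
        _ ≤ M * l ^ k := by
          gcongr ?_ * ?_
          exact pow_le_pow_of_le_one hl0.le hl1.le hk
    have h2 : 0 ≤ ⌊M * l ^ k⌋ + 1 - 0 := by
      have : 0 ≤ ⌊M * l ^ k⌋ := Int.floor_nonneg.2 (by positivity)
      omega
    have h3 : ((Finset.Icc 0 ⌊M * l ^ k⌋).card : ℝ) = (⌊M * l ^ k⌋ : ℝ) + 1 := by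
      rw [Int.card_Icc]
      have := Int.toNat_of_nonneg h2
      rw [← Int.cast_natCast, this]
      push_cast
      ring
    rw [h3]
    linarith [Int.floor_le (M * l ^ k)]
  have hgrid : (((Finset.Icc (0 : ℤ) (2 ^ m)) ×ˢ Finset.Icc 0 ⌊M * l ^ m⌋).card : ℝ) ≤
      4 * (4 * l) ^ m := by
    have h1 : ((Finset.Icc (0 : ℤ) (2 ^ m)).card : ℝ) ≤ 2 * M := by
      have : (Finset.Icc (0 : ℤ) (2 ^ m)).card = 2 ^ m + 1 := by
        rw [Int.card_Icc]
        have : (2 : ℤ) ^ m + 1 - 0 = ((2 ^ m + 1 : ℕ) : ℤ) := by push_cast; ring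
        rw [this, Int.toNat_natCast]
      rw [this]
      have : (1 : ℝ) ≤ M := one_le_pow₀ (by norm_num)
      push_cast
      linarith
    rw [Finset.card_product, Nat.cast_mul]
    calc _ ≤ (2 * M) * (2 * (M * l ^ m)) := by
          gcongr
          exact hcol m le_rfl
      _ = 4 * (4 * l) ^ m := by
          rw [mul_pow, show (4 : ℝ) = 2 * 2 by norm_num, mul_pow]
          ring
  have hsum : (((Finset.range m).biUnion fun k =>
      (Finset.univ : Finset (Fin k → Fin 2)).biUnion fun w =>
        ({⌊M * wordPoint l w⌋} ×ˢ Finset.Icc 0 ⌊M * l ^ k⌋ : Finset (ℤ × ℤ))).card : ℝ) ≤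
      2 / (2 * l - 1) * (4 * l) ^ m := by
    calc _ ≤ ((∑ k ∈ Finset.range m, 2 ^ k * (Finset.Icc 0 ⌊M * l ^ k⌋).card : ℕ) : ℝ) := by
          refine Nat.cast_le.2 (Finset.card_biUnion_le.trans (Finset.sum_le_sum fun k _ => ?_))
          refine Finset.card_biUnion_le.trans ?_
          simp
      _ ≤ ∑ k ∈ Finset.range m, 2 * M * (2 * l) ^ k := by
          push_cast
          refine Finset.sum_le_sum fun k hk => ?_
          calc _ ≤ (2 : ℝ) ^ k * (2 * (M * l ^ k)) := by
                gcongr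
                exact hcol k (Finset.mem_range.1 hk).le
            _ = _ := by rw [mul_pow]; ring
      _ = 2 * M * (((2 * l) ^ m - 1) / (2 * l - 1)) := by
          rw [← Finset.mul_sum, geom_sum_eq (by linarith)]
      _ ≤ 2 * M * ((2 * l) ^ m / (2 * l - 1)) := by
          have : 0 < 2 * l - 1 := by linarith
          gcongr
          linarith
      _ = 2 / (2 * l - 1) * (4 * l) ^ m := by
          rw [show 4 * l = 2 * (2 * l) by ring, mul_pow 2 (2 * l)]
          ring
  calc (boxCount δ F : ℝ) ≤ T.card := Nat.cast_le.2 hcount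
    _ ≤ _ := by
      refine (Nat.cast_le.2 (Finset.card_union_le _ _)).trans ?_
      push_cast
      linarith

end Attractor

/-! ### From dyadic scales to the dimension -/

open Filter Topology in
theorem hasBoxDim_attractor {l c : ℝ} {F : Set (EuclideanSpace ℝ (Fin 2))}
    (hl : 1 / 2 < l) (hl1 : l < 1) (hc0 : 0 < c) (hc1 : c ≤ 1)
    (hc : ∀ (n : ℕ) (v w : Fin n → Fin 2), v ≠ w →
      c / 2 ^ n ≤ |wordPoint l v - wordPoint l w|)
    (hF : IsInhomogeneousAttractor unitSquare (bernoulliIFS l) leftEdge F) :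
    HasBoxDim F (Real.log (4 * l) / Real.log 2) := by
  have hl0 : 0 < l := by linarith
  set s := Real.log (4 * l) / Real.log 2 with hs
  have hlog2 : 0 < Real.log 2 := Real.log_pos (by norm_num)
  have hs0 : 0 ≤ s := div_nonneg (Real.log_nonneg (by linarith)) hlog2.le
  have hpow : ∀ m : ℕ, (4 * l) ^ m = ((2 : ℝ) ^ m) ^ s := by
    intro m
    rw [← Real.rpow_natCast_mul (by norm_num), mul_comm (m : ℝ),
      Real.rpow_mul_natCast (by norm_num),
      hs, Real.rpow_def_of_pos (by norm_num : (0 : ℝ) < 2), mul_div_cancel₀ _ hlog2.ne',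
      Real.exp_log (by linarith)]
  have hK : 0 < 4 + 2 / (2 * l - 1) := by
    have : 0 < 2 * l - 1 := by linarith
    positivity
  have hsmall : ∀ᶠ δ in 𝓝[>] (0 : ℝ), δ < c / 2 :=
    nhdsWithin_le_nhds (eventually_lt_nhds (by positivity))
  refine hasBoxDim_of_boxCount_bounds (A := (c / 4) ^ s)
    (B := (4 + 2 / (2 * l - 1)) * 4 ^ s) (by positivity) ?_ ?_
  · filter_upwards [hsmall, self_mem_nhdsWithin] with δ h1 h2
    have h2 : 0 < δ := h2
    -- The factor 2 makes δ < c/2^m strict, as separation requires.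
    obtain ⟨m, hm1, hm2⟩ := exists_nat_pow_near (x := c / (2 * δ)) (y := 2)
      ((one_le_div (by positivity)).2 (by linarith)) (by norm_num)
    have hδm : δ < c / 2 ^ m := by
      rw [le_div_iff₀ (by positivity)] at hm1
      rw [lt_div_iff₀ (by positivity)]
      nlinarith
    calc (c / 4) ^ s * δ ^ (-s) = (c / 4 / δ) ^ s := by
          rw [Real.rpow_neg h2.le, Real.div_rpow (by positivity) h2.le, ← div_eq_mul_inv]
      _ ≤ ((2 : ℝ) ^ m) ^ s := by
          refine Real.rpow_le_rpow (by positivity) ?_ hs0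
          have : c / 4 / δ = c / (2 * δ) / 2 := by field_simp; norm_num
          rw [this]
          rw [pow_succ] at hm2
          linarith
      _ = (4 * l) ^ m := (hpow m).symm
      _ ≤ _ := le_boxCount_attractor hl0 hc1 hc hF h2 hδm
  · filter_upwards [hsmall, self_mem_nhdsWithin] with δ h1 h2
    have h2 : 0 < δ := h2
    obtain ⟨m, hm1, hm2⟩ := exists_nat_pow_near (x := 2 / δ) (y := 2)
      ((one_le_div (by positivity)).2 (by linarith)) (by norm_num)
    have hδm : 2 / 2 ^ (m + 1) ≤ δ := by
      rw [div_lt_iff₀ h2] at hm2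
      rw [div_le_iff₀ (by positivity)]
      linarith
    calc (boxCount δ F : ℝ) ≤ (4 + 2 / (2 * l - 1)) * (4 * l) ^ (m + 1) :=
          boxCount_attractor_le hl hl1 hF hδm
      _ = (4 + 2 / (2 * l - 1)) * ((2 : ℝ) ^ (m + 1)) ^ s := by rw [hpow]
      _ ≤ (4 + 2 / (2 * l - 1)) * (4 / δ) ^ s := by
          gcongr
          have : 4 / δ = 2 / δ * 2 := by ring
          rw [this, pow_succ]
          gcongr
      _ = (4 + 2 / (2 * l - 1)) * 4 ^ s * δ ^ (-s) := by
          rw [Real.rpow_neg h2.le, Real.div_rpow (by norm_num) h2.le, mul_assoc, ← div_eq_mul_inv]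

theorem theorem4p1 (l : ℝ) (hl : l ∈ Set.Ioo (1 / 2 : ℝ) 1)
    (hG : ∃ β : ℝ, IsGarsiaNumber β ∧ l = 1 / β) :
    (∃! F : Set (EuclideanSpace ℝ (Fin 2)),
      IsInhomogeneousAttractor unitSquare (bernoulliIFS l) leftEdge F) ∧
    (∀ F : Set (EuclideanSpace ℝ (Fin 2)),
      IsInhomogeneousAttractor unitSquare (bernoulliIFS l) leftEdge F →
        HasBoxDim F (Real.log (4 * l) / Real.log 2)) ∧
    1 < Real.log (4 * l) / Real.log 2 := by
  obtain ⟨hl2, hl1⟩ := hl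
  have hl0 : 0 < l := by linarith
  obtain ⟨β, hβ, hlβ⟩ := hG
  refine ⟨?_, ?_, ?_⟩
  · have hne : leftEdge.Nonempty := ⟨0, by simp [leftEdge]⟩
    obtain ⟨F, hF⟩ := exists_isInhomogeneousAttractor (S := bernoulliIFS l) isCompact_unitSquare
      isCompact_leftEdge leftEdge_subset_unitSquare hne (continuous_bernoulliIFS l)
      (bernoulliIFS_injective hl0) fun i p hp => bernoulliIFS_mem_unitSquare hl0 hl1 i hp
    refine ⟨F, hF, fun G hG => Set.Subset.antisymm ?_ ?_⟩
    · exact hG.subset_of_contracting hl0 hl1 (dist_bernoulliIFS hl0) hF hF.2.2.1.isClosed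
    · exact hF.subset_of_contracting hl0 hl1 (dist_bernoulliIFS hl0) hG hG.2.2.1.isClosed
  · intro F hF
    obtain ⟨c, hc0, hc⟩ := exists_le_abs_wordPoint_sub hl1 hβ hlβ
    -- Truncating at 1 also covers the vertical spacing 2^(-m).
    refine hasBoxDim_attractor (c := min c 1) hl2 hl1 (lt_min hc0 one_pos) (min_le_right _ _)
      (fun n v w hvw => le_trans ?_ (hc n v w hvw)) hF
    gcongr
    exact min_le_left _ _
  · rw [one_lt_div (Real.log_pos (by norm_num))]
    exact Real.log_lt_log (by norm_num) (by linarith)
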